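/- Let $F$ be a field of characteristic $p \ge 3$ and let $n \ge 0$ be an integer. Let $A(n) = F[x_1,\dots,x_n]/(x_1^p,\dots,x_n^p)$ be the truncated polynomial ring and let $W(n) = \mathrm{Der}_F A(n)$ be the Witt–Jacobson Lie algebra of its $F$-linear derivations, with the commutator bracket. Then the first cohomology group of $W(n)$ with coefficients in the adjoint representation vanishes, $$H^1(W(n), W(n)) = 0;$$ that is, every derivation of the Lie algebra $W(n)$ is inner: for every $F$-linear map $D : W(n) \to W(n)$ with $D([Y,Z]) = [D(Y),Z] + [Y,D(Z)]$ for all $Y, Z \in W(n)$, there is $X \in W(n)$ with $D(Y) = [X,Y]$ for all $Y \in W(n)$. -/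

import Mathlib

namespace LieModule.Cohomology

variable (R : Type*) [CommRing R]
variable (L : Type*) [LieRing L] [LieAlgebra R L]
variable (M : Type*) [AddCommGroup M] [Module R M] [LieRingModule L M] [LieModule R L M]

/-- The Chevalley–Eilenberg differential `C⁰(L, M) = M → C¹(L, M)`, `m ↦ (x ↦ x · m)`. -/
def d₀₁ : M →ₗ[R] oneCochain R L M where
  toFun m :=
    { toFun := fun x => ⁅x, m⁆
      map_add' := fun x y => add_lie x y m
      map_smul' := fun t x => smul_lie t x m }
  map_add' m m' := by ext x; simp
  map_smul' t m := by ext x; simp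

/-- The `1`-cocycles `Z¹(L, M)`: the kernel of `d : C¹(L, M) → C²(L, M)`. -/
def oneCocycle : Submodule R (oneCochain R L M) := LinearMap.ker (d₁₂ R L M)

/-- The `1`-coboundaries `B¹(L, M)`: the image of `d : C⁰(L, M) → C¹(L, M)`. -/
def oneCoboundary : Submodule R (oneCochain R L M) := LinearMap.range (d₀₁ R L M)

theorem oneCoboundary_le_oneCocycle : oneCoboundary R L M ≤ oneCocycle R L M := by
  rintro _ ⟨m, rfl⟩
  refine LinearMap.mem_ker.2 (Subtype.ext ?_)
  ext x y
  simp [d₀₁]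

/-- The first cohomology group `H¹(L, M) = Z¹(L, M) / B¹(L, M)`. -/
abbrev H1 : Type _ := oneCocycle R L M ⧸ (oneCoboundary R L M).submoduleOf (oneCocycle R L M)

end LieModule.Cohomology

/-- The truncated polynomial ring `A(n) = F[x₁, …, xₙ] / (x₁ᵖ, …, xₙᵖ)`. -/
abbrev TruncatedPolynomial (F : Type*) [Field F] (p n : ℕ) : Type _ :=
  MvPolynomial (Fin n) F ⧸
    Ideal.span (Set.range fun i : Fin n => (MvPolynomial.X i : MvPolynomial (Fin n) F) ^ p)

/-- The Witt–Jacobson algebra `W(n) = Der_F A(n)`, with the commutator bracket. -/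
abbrev WittJacobson (F : Type*) [Field F] (p n : ℕ) : Type _ :=
  Derivation F (TruncatedPolynomial F p n) (TruncatedPolynomial F p n)

/-! A derivation `D` is reduced to zero by subtracting inner derivations. Since the ∂ᵢ commute, the
coefficients of the D(∂ᵢ) form closed families. In characteristic p closed does not imply exact,
because xᵢ^(p-1) is not a ∂ᵢ-derivative; `exists_partialDeriv_eq_apply` removes this obstruction by
applying D to [∂ᵢ, xₗ∂ᵢ]. A Poincaré lemma then makes D inner on the ∂ᵢ. If D kills the ∂ᵢ, its
values on the commuting toral elements xᵢ∂ᵢ are constant vector fields, and a constant field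
corrects them (`exists_inner_eq_on_toral`). What remains commutes with every ad ∂ᵢ and preserves
weights modulo p. By induction on degree, D(xᵃ∂ⱼ) is constant, so if it is nonzero the weight of
xᵃ∂ⱼ is that of some ∂ₖ. This leaves ∂ⱼ itself and xₖ^(p-1)xⱼ∂ⱼ with k ≠ j; the latter is half the
bracket of xₖ^(p-1)∂ⱼ and xⱼ²∂ⱼ, both of lower degree since p ≥ 3. -/

open MvPolynomial

/-! ### Coefficients and monomials of the truncated polynomial ring. -/

namespace TruncatedPolynomial

variable {F : Type*} [Field F] {p n : ℕ}

/-- The defining ideal `(x₁ᵖ, …, xₙᵖ)` consists of the polynomials all of whose monomials have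
some exponent at least `p`. -/
theorem mk_eq_zero_iff (f : MvPolynomial (Fin n) F) :
    (Ideal.Quotient.mk _ f : TruncatedPolynomial F p n) = 0 ↔
      ∀ a : Fin n →₀ ℕ, (∀ i, a i < p) → coeff a f = 0 := by
  have hset : (Set.range fun i : Fin n => (X i : MvPolynomial (Fin n) F) ^ p) =
      (fun s => monomial s (1 : F)) '' Set.range fun i : Fin n => Finsupp.single i p := by
    rw [← Set.range_comp]
    simp [Function.comp_def, X_pow_eq_monomial]
  rw [Ideal.Quotient.eq_zero_iff_mem, hset, mem_ideal_span_monomial_image]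
  simp only [Set.mem_range, exists_exists_eq_and, Finsupp.single_le_iff, mem_support_iff]
  refine forall_congr' fun a => ?_
  rw [← not_imp_not]
  simp

/-- The coefficient of the monomial `xᵃ`; it is zero when some exponent is at least `p`. -/
noncomputable def coeffₗ (a : Fin n →₀ ℕ) : TruncatedPolynomial F p n →ₗ[F] F :=
  open scoped Classical in
  if h : ∀ i, a i < p then
    (Submodule.liftQ _ (lcoeff F a) fun f hf => LinearMap.mem_ker.2 <|
      (mk_eq_zero_iff f).1 (Ideal.Quotient.eq_zero_iff_mem.2 hf) a h) ∘ₗ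
      (Submodule.Quotient.restrictScalarsEquiv F (Ideal.span (Set.range fun i : Fin n =>
        (X i : MvPolynomial (Fin n) F) ^ p))).symm.toLinearMap
  else 0

theorem coeffₗ_mk {a : Fin n →₀ ℕ} (h : ∀ i, a i < p) (f : MvPolynomial (Fin n) F) :
    coeffₗ a (Ideal.Quotient.mk _ f : TruncatedPolynomial F p n) = coeff a f := by
  rw [coeffₗ, dif_pos h]
  rfl

theorem coeffₗ_of_not {a : Fin n →₀ ℕ} (h : ¬ ∀ i, a i < p) (f : TruncatedPolynomial F p n) :
    coeffₗ a f = 0 := by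
  rw [coeffₗ, dif_neg h]
  rfl

theorem ext_coeffₗ {f g : TruncatedPolynomial F p n}
    (h : ∀ a : Fin n →₀ ℕ, (∀ i, a i < p) → coeffₗ a f = coeffₗ a g) : f = g := by
  rw [← sub_eq_zero]
  obtain ⟨u, hu⟩ := Ideal.Quotient.mk_surjective (f - g)
  rw [← hu, mk_eq_zero_iff]
  intro a ha
  rw [← coeffₗ_mk ha, hu, map_sub, h a ha, sub_self]

/-- Any prescribed family of coefficients is attained. -/
theorem exists_coeffₗ_eq (G : (Fin n →₀ ℕ) → F) :
    ∃ g : TruncatedPolynomial F p n, ∀ a : Fin n →₀ ℕ, (∀ i, a i < p) → coeffₗ a g = G a := by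
  classical
  refine ⟨Ideal.Quotient.mk _
    (∑ a ∈ Finset.Iic (Finsupp.equivFunOnFinite.symm fun _ => p), monomial a (G a)), ?_⟩
  intro a ha
  rw [coeffₗ_mk ha, coeff_sum]
  simp only [coeff_monomial, Finset.sum_ite_eq', Finset.mem_Iic]
  rw [if_pos]
  intro i
  simpa using (ha i).le

variable (F p n) in
/-- The class of the variable `xᵢ`. -/
noncomputable def x (i : Fin n) : TruncatedPolynomial F p n := Ideal.Quotient.mk _ (X i)

variable (F p) in
/-- The class of the monomial `xᵃ`. -/
noncomputable def mono (a : Fin n →₀ ℕ) : TruncatedPolynomial F p n :=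
  Ideal.Quotient.mk _ (monomial a 1)

theorem mono_zero : mono F p (0 : Fin n →₀ ℕ) = 1 := rfl

theorem mono_add_single (a : Fin n →₀ ℕ) (i : Fin n) (k : ℕ) :
    mono F p (a + Finsupp.single i k) = mono F p a * x F p n i ^ k := by
  rw [mono, mono, x, ← map_pow, ← map_mul, X_pow_eq_monomial, monomial_mul, one_mul]

theorem mono_single (i : Fin n) (k : ℕ) :
    mono F p (Finsupp.single i k) = x F p n i ^ k := by
  simpa [mono_zero] using mono_add_single (F := F) (p := p) 0 i k

theorem mono_eq_zero {a : Fin n →₀ ℕ} (h : ¬ ∀ i, a i < p) : mono F p a = 0 := by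
  classical
  refine ext_coeffₗ fun b hb => ?_
  rw [mono, coeffₗ_mk hb, coeff_monomial, if_neg, map_zero]
  rintro rfl
  exact h hb

theorem span_mono : Submodule.span F (Set.range (mono F p (n := n))) = ⊤ := by
  refine eq_top_iff.2 fun f _ => ?_
  obtain ⟨u, rfl⟩ := Ideal.Quotient.mk_surjective f
  induction u using MvPolynomial.induction_on' with
  | monomial a c =>
    have : (Ideal.Quotient.mk _ (monomial a c) : TruncatedPolynomial F p n) = c • mono F p a := by
      change _ = Ideal.Quotient.mk _ (c • monomial a (1 : F))
      rw [smul_monomial, smul_eq_mul, mul_one]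
    rw [this]
    exact Submodule.smul_mem _ _ (Submodule.subset_span ⟨a, rfl⟩)
  | add u v hu hv =>
    rw [map_add]
    exact Submodule.add_mem _ (hu trivial) (hv trivial)

/-! ### Partial derivatives and the Poincaré lemma. -/

section Derivations

variable [CharP F p]

/-- Raising the exponent of xᵢ leaves the range below p only at aᵢ = p - 1, where the factor aᵢ + 1
vanishes in F. Hence ∂ᵢ descends to the quotient. -/
theorem mk_pderiv_eq_zero (i : Fin n) (f : MvPolynomial (Fin n) F)
    (hf : (Ideal.Quotient.mk _ f : TruncatedPolynomial F p n) = 0) :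
    (Ideal.Quotient.mk _ (pderiv i f) : TruncatedPolynomial F p n) = 0 := by
  refine (mk_eq_zero_iff _).2 fun a ha => ?_
  rw [coeff_pderiv]
  by_cases h : a i + 1 = p
  · have : (a i + 1 : F) = 0 := by exact_mod_cast (CharP.cast_eq_zero_iff F p _).2 h.symm.dvd
    rw [this, mul_zero]
  · rw [(mk_eq_zero_iff f).1 hf, zero_mul]
    intro j
    by_cases hj : j = i
    · subst hj
      have := ha j
      simp only [Finsupp.add_apply, Finsupp.single_eq_same]
      omega
    · simpa [Finsupp.single_apply, Ne.symm hj] using ha j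

variable (F p) in
/-- The partial derivative `∂ᵢ` on the truncated polynomial ring. -/
noncomputable def partialDeriv (i : Fin n) : WittJacobson F p n :=
  Derivation.liftOfSurjective (f := Ideal.Quotient.mkₐ F _) (Ideal.Quotient.mkₐ_surjective F _)
    (mk_pderiv_eq_zero i)

theorem partialDeriv_mk (i : Fin n) (f : MvPolynomial (Fin n) F) :
    partialDeriv F p i (Ideal.Quotient.mk _ f) =
      Ideal.Quotient.mk _ (pderiv i f) :=
  Derivation.liftOfSurjective_apply (f := Ideal.Quotient.mkₐ F _)
    (Ideal.Quotient.mkₐ_surjective F _) (mk_pderiv_eq_zero i) f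

theorem partialDeriv_x (i j : Fin n) :
    partialDeriv F p i (x F p n j) = if j = i then 1 else 0 := by
  rw [x, partialDeriv_mk, pderiv_X]
  by_cases h : j = i <;> simp [h]

theorem partialDeriv_mono (i : Fin n) (a : Fin n →₀ ℕ) :
    partialDeriv F p i (mono F p a) =
      (a i : F) • mono F p (a - Finsupp.single i 1) := by
  rw [mono, partialDeriv_mk, pderiv_monomial, one_mul]
  change _ = Ideal.Quotient.mk _ ((a i : F) • monomial _ (1 : F))
  rw [smul_monomial, smul_eq_mul, mul_one]

theorem x_mul_partialDeriv_mono (i : Fin n) (a : Fin n →₀ ℕ) :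
    x F p n i * partialDeriv F p i (mono F p a) = (a i : F) • mono F p a := by
  rw [partialDeriv_mono, mul_smul_comm]
  by_cases h : a i = 0
  · simp [h]
  · rw [mul_comm, ← pow_one (x F p n i), ← mono_add_single, tsub_add_cancel_of_le]
    rw [Finsupp.single_le_iff]
    omega

/-- No bound on `a` is needed: coefficients with an exponent at least p are zero by convention, in
agreement with the vanishing of aᵢ + 1 at aᵢ = p - 1. -/
theorem coeffₗ_partialDeriv (a : Fin n →₀ ℕ) (i : Fin n) (f : TruncatedPolynomial F p n) :
    coeffₗ a (partialDeriv F p i f) =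
      (a i + 1) * coeffₗ (a + Finsupp.single i 1) f := by
  obtain ⟨u, rfl⟩ := Ideal.Quotient.mk_surjective f
  by_cases ha' : ∀ j, (a + Finsupp.single i 1 : Fin n →₀ ℕ) j < p
  · have ha : ∀ j, a j < p := fun j => lt_of_le_of_lt (by simp) (ha' j)
    rw [partialDeriv_mk, coeffₗ_mk ha, coeffₗ_mk ha', coeff_pderiv, mul_comm]
  · rw [coeffₗ_of_not ha', mul_zero]
    by_cases ha : ∀ j, a j < p
    · rw [partialDeriv_mk, coeffₗ_mk ha, coeff_pderiv]
      push Not at ha'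
      obtain ⟨j, hj⟩ := ha'
      have hji : j = i := by
        by_contra hne
        have := ha j
        simp [Ne.symm hne] at hj
        omega
      subst hji
      have h := ha j
      simp only [Finsupp.add_apply, Finsupp.single_eq_same] at hj
      have : (a j + 1 : F) = 0 := by
        exact_mod_cast (CharP.cast_eq_zero_iff F p _).2 (by rw [show a j + 1 = p by omega])
      rw [this, mul_zero]
    · rw [coeffₗ_of_not ha]

theorem mul_coeffₗ (a : Fin n →₀ ℕ) {i : Fin n} (h : a i ≠ 0) (f : TruncatedPolynomial F p n) :
    (a i : F) * coeffₗ a f =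
      coeffₗ (a - Finsupp.single i 1) (partialDeriv F p i f) := by
  have hle : Finsupp.single i 1 ≤ a := by
    rw [Finsupp.single_le_iff]
    omega
  rw [coeffₗ_partialDeriv, tsub_add_cancel_of_le hle]
  congr 1
  rw [Finsupp.tsub_apply, Finsupp.single_eq_same]
  exact_mod_cast congrArg (Nat.cast (R := F)) (by omega : a i = a i - 1 + 1)

/-- An element killed by all partial derivatives is constant. -/
theorem exists_eq_algebraMap {f : TruncatedPolynomial F p n}
    (h : ∀ i, partialDeriv F p i f = 0) :
    ∃ c : F, f = algebraMap F _ c := by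
  classical
  refine ⟨coeffₗ 0 f, ext_coeffₗ fun a ha => ?_⟩
  have hC : coeffₗ a (algebraMap F (TruncatedPolynomial F p n) (coeffₗ 0 f)) =
      if 0 = a then coeffₗ 0 f else 0 := by
    rw [← coeff_C, ← coeffₗ_mk ha]
    rfl
  rw [hC]
  split_ifs with h0
  · rw [← h0]
  · obtain ⟨i, hi⟩ : ∃ i, a i ≠ 0 := by
      by_contra! hc
      exact h0 (Finsupp.ext fun i => (hc i).symm)
    have := mul_coeffₗ a hi f
    rw [h i, map_zero, mul_eq_zero, CharP.cast_eq_zero_iff F p] at this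
    exact this.resolve_left (Nat.not_dvd_of_pos_of_lt (Nat.pos_of_ne_zero hi) (ha i))

/-- A Poincaré lemma: a closed family whose `i`-th member is a `∂ᵢ`-derivative is a gradient. -/
theorem exists_partialDeriv_eq {f : Fin n → TruncatedPolynomial F p n}
    (closed : ∀ i k, partialDeriv F p k (f i) =
      partialDeriv F p i (f k))
    (integrable : ∀ i, ∃ u, partialDeriv F p i u = f i) :
    ∃ g, ∀ i, partialDeriv F p i g = f i := by
  classical
  -- Any direction i with aᵢ ≠ 0 forces the coefficient of `g` at a. One direction is chosen, and
  -- closedness makes the choice immaterial.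
  obtain ⟨g, hg⟩ := exists_coeffₗ_eq (F := F) (p := p) (n := n) fun a =>
    if h : ∃ i, a i ≠ 0 then (coeffₗ (a - Finsupp.single h.choose 1) (f h.choose)) / a h.choose
    else 0
  refine ⟨g, fun i => ext_coeffₗ fun b hb => ?_⟩
  rw [coeffₗ_partialDeriv]
  by_cases ha : ∀ j, (b + Finsupp.single i 1 : Fin n →₀ ℕ) j < p
  · set a := b + Finsupp.single i 1 with hadef
    have hai : a i ≠ 0 := by simp [a]
    have hb' : b = a - Finsupp.single i 1 := by simp [a]
    have hex : ∃ i, a i ≠ 0 := ⟨i, hai⟩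
    rw [hg a ha, dif_pos hex]
    have hk := hex.choose_spec
    set k := hex.choose
    have hk0 : (a k : F) ≠ 0 := by
      rw [Ne, CharP.cast_eq_zero_iff F p]
      exact Nat.not_dvd_of_pos_of_lt (Nat.pos_of_ne_zero hk) (ha k)
    have hbi : (b i + 1 : F) = a i := by simp [a]
    rw [hbi, hb', mul_div_assoc', div_eq_iff hk0]
    by_cases hki : k = i
    · rw [hki, mul_comm]
    · have h1 := mul_coeffₗ (F := F) (p := p) (a - Finsupp.single k 1) (i := i)
        (by simpa [Finsupp.single_apply, hki] using hai) (f k)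
      have h2 := mul_coeffₗ (F := F) (p := p) (a - Finsupp.single i 1) (i := k)
        (by simpa [Finsupp.single_apply, Ne.symm hki] using hk) (f i)
      rw [closed i k, tsub_right_comm, ← h1] at h2
      simp only [Finsupp.tsub_apply, Finsupp.single_apply, hki, Ne.symm hki, if_false,
        tsub_zero] at h2
      rw [← h2, mul_comm]
  -- Here bᵢ = p - 1: no ∂ᵢ-derivative has such a monomial, so only integrability can make the
  -- coefficient of `f i` vanish.
  · obtain ⟨u, hu⟩ := integrable i
    rw [← hu, coeffₗ_partialDeriv, coeffₗ_of_not ha, coeffₗ_of_not ha]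

end Derivations

end TruncatedPolynomial

/-! ### Correcting a derivation by inner ones. -/

namespace LieDerivation

variable {R L : Type*} [CommRing R] [LieRing L] [LieAlgebra R L] (D : LieDerivation R L L)

theorem apply_lie_of_left {x : L} (hx : D x = 0) (y : L) : D ⁅x, y⁆ = ⁅x, D y⁆ := by
  rw [D.apply_lie_eq_add, hx, zero_lie, add_zero]

theorem apply_lie_eq_zero {x y : L} (hx : D x = 0) (hy : D y = 0) : D ⁅x, y⁆ = 0 := by
  rw [D.apply_lie_of_left hx, hy, lie_zero]

theorem exists_apply_eq_sub_lie (x : L) : ∃ D' : LieDerivation R L L, ∀ y, D' y = D y - ⁅x, y⁆ :=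
  ⟨D - ad R L x, fun y => by rw [sub_apply, ad_apply_apply]⟩

/-- A derivation that is inner up to an inner derivation is inner. -/
theorem exists_eq_lie_of_sub (x : L) (h : ∀ D' : LieDerivation R L L,
    (∀ y, D' y = D y - ⁅x, y⁆) → ∃ z : L, ∀ y, D' y = ⁅z, y⁆) : ∃ z : L, ∀ y, D y = ⁅z, y⁆ := by
  obtain ⟨D', hD'⟩ := D.exists_apply_eq_sub_lie x
  obtain ⟨z, hz⟩ := h D' hD'
  exact ⟨x + z, fun y => by rw [add_lie, ← hz, hD', add_sub_cancel]⟩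

end LieDerivation

/-! ### Vector fields in coordinates and their brackets. -/

namespace WittJacobson

open TruncatedPolynomial

variable {F : Type*} [Field F] {p n : ℕ}

/-- A derivation is determined by its values on the variables. -/
theorem ext_x {Y Z : WittJacobson F p n} (h : ∀ i, Y (x F p n i) = Z (x F p n i)) : Y = Z := by
  refine Derivation.ext fun f => ?_
  obtain ⟨u, rfl⟩ := Ideal.Quotient.mk_surjective f
  induction u using MvPolynomial.induction_on with
  | C c => exact (Y.map_algebraMap c).trans (Z.map_algebraMap c).symm
  | add u v hu hv => rw [map_add, map_add, map_add, hu, hv]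
  | mul_X u i hu =>
    have := h i
    rw [x] at this
    rw [map_mul, Derivation.leibniz, Derivation.leibniz, hu, this]

variable [CharP F p]

theorem smul_partialDeriv_x (g : TruncatedPolynomial F p n) (i l : Fin n) :
    (g • partialDeriv F p i : WittJacobson F p n) (x F p n l) = if l = i then g else 0 := by
  rw [Derivation.smul_apply, partialDeriv_x, smul_eq_mul]
  split_ifs <;> simp

theorem zero_smul_partialDeriv (i : Fin n) :
    (0 : TruncatedPolynomial F p n) • partialDeriv F p i = 0 :=
  ext_x fun l => by rw [smul_partialDeriv_x, ite_self, Derivation.zero_apply]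

/-- The vector field with prescribed values on the variables. -/
noncomputable def ofCoords (g : Fin n → TruncatedPolynomial F p n) : WittJacobson F p n :=
  ∑ l, g l • partialDeriv F p l

theorem ofCoords_x (g : Fin n → TruncatedPolynomial F p n) (l : Fin n) :
    ofCoords g (x F p n l) = g l := by
  have : ofCoords g (x F p n l) = ∑ k, (g k • partialDeriv F p k) (x F p n l) := by
    rw [ofCoords, ← Derivation.coeFnAddMonoidHom_apply, map_sum, Finset.sum_apply]
    rfl
  rw [this]
  simp_rw [smul_partialDeriv_x]
  simp

theorem apply_partialDeriv_x (Y : WittJacobson F p n) (i l : Fin n) :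
    Y (partialDeriv F p i (x F p n l)) = 0 := by
  rw [partialDeriv_x]
  split_ifs
  · exact Y.map_one_eq_zero
  · exact map_zero Y

theorem partialDeriv_lie_x (Y : WittJacobson F p n) (i l : Fin n) :
    ⁅partialDeriv F p i, Y⁆ (x F p n l) = partialDeriv F p i (Y (x F p n l)) := by
  rw [Derivation.commutator_apply, apply_partialDeriv_x, sub_zero]

theorem lie_partialDeriv_x (Y : WittJacobson F p n) (i l : Fin n) :
    ⁅Y, partialDeriv F p i⁆ (x F p n l) = -partialDeriv F p i (Y (x F p n l)) := by
  rw [Derivation.commutator_apply, apply_partialDeriv_x, zero_sub]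

theorem lie_partialDeriv_partialDeriv (i k : Fin n) :
    ⁅partialDeriv F p i, partialDeriv F p k⁆ = 0 :=
  ext_x fun l => by rw [partialDeriv_lie_x, apply_partialDeriv_x, Derivation.zero_apply]

/-- A vector field commuting with all partial derivatives has constant coefficients. -/
theorem exists_coords_of_lie_eq_zero {Y : WittJacobson F p n}
    (h : ∀ k : Fin n, ⁅partialDeriv F p k, Y⁆ = 0) :
    ∃ c : Fin n → F, ∀ l, Y (x F p n l) = algebraMap F _ (c l) := by
  have (l : Fin n) : ∃ c : F, Y (x F p n l) = algebraMap F _ c :=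
    exists_eq_algebraMap fun k => by rw [← partialDeriv_lie_x, h, Derivation.zero_apply]
  choose c hc using this
  exact ⟨c, hc⟩

variable (F p) in
/-- The toral element `xᵢ ∂ᵢ`. -/
noncomputable def toral (i : Fin n) : WittJacobson F p n := x F p n i • partialDeriv F p i

theorem toral_x (i l : Fin n) : toral F p i (x F p n l) = if l = i then x F p n l else 0 := by
  rw [toral, smul_partialDeriv_x]
  split_ifs with h
  · rw [h]
  · rfl

theorem partialDeriv_lie_toral (k i : Fin n) :
    ⁅partialDeriv F p k, toral F p i⁆ = if k = i then partialDeriv F p i else 0 := by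
  refine ext_x fun l => ?_
  rw [partialDeriv_lie_x, toral_x]
  split_ifs with h1 h2 h2
  · rw [h2]
  · rw [h1, partialDeriv_x, if_neg (Ne.symm h2), Derivation.zero_apply]
  · rw [map_zero, partialDeriv_x, if_neg h1]
  · rw [map_zero, Derivation.zero_apply]

theorem toral_lie_toral (i k : Fin n) : ⁅toral F p i, toral F p k⁆ = 0 := by
  refine ext_x fun l => ?_
  rw [Derivation.commutator_apply, Derivation.zero_apply, toral_x, toral_x]
  split_ifs with h1 h2 h2
  · rw [toral_x, toral_x, if_pos h1, if_pos h2, sub_self]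
  · rw [toral_x, if_neg h2, map_zero, sub_zero]
  · rw [toral_x, if_neg h1, map_zero, sub_zero]
  · rw [map_zero, map_zero, sub_zero]

theorem toral_lie_mono (i j : Fin n) (a : Fin n →₀ ℕ) :
    ⁅toral F p i, mono F p a • partialDeriv F p j⁆ =
      ((a i : F) - if i = j then 1 else 0) • (mono F p a • partialDeriv F p j) := by
  refine ext_x fun l => ?_
  rw [Derivation.commutator_apply, Derivation.smul_apply _ (_ - _), smul_partialDeriv_x, toral_x]
  by_cases hl : l = j
  · subst hl
    rw [if_pos rfl, toral, Derivation.smul_apply, smul_eq_mul, x_mul_partialDeriv_mono, sub_smul]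
    by_cases hi : l = i
    · subst hi
      rw [if_pos rfl, smul_partialDeriv_x, if_pos rfl, if_pos rfl, one_smul]
    · rw [if_neg hi, if_neg (Ne.symm hi), map_zero, zero_smul]
  · rw [if_neg hl, map_zero, smul_zero]
    split_ifs
    · rw [smul_partialDeriv_x, if_neg hl, sub_zero]
    · rw [map_zero, sub_zero]

theorem partialDeriv_lie_mono (k j : Fin n) (a : Fin n →₀ ℕ) :
    ⁅partialDeriv F p k, mono F p a • partialDeriv F p j⁆ =
      (a k : F) • (mono F p (a - Finsupp.single k 1) • partialDeriv F p j : WittJacobson F p n) := by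
  refine ext_x fun l => ?_
  rw [partialDeriv_lie_x, Derivation.smul_apply _ (a k : F), smul_partialDeriv_x, smul_partialDeriv_x]
  split_ifs
  · rw [partialDeriv_mono]
  · rw [map_zero, smul_zero]

/-- As xᵇ does not involve xⱼ, only the derivative of xⱼ² contributes. This reaches the exceptional
field xₖ^(p-1)xⱼ∂ⱼ from lower degrees. -/
theorem mono_lie_sq {b : Fin n →₀ ℕ} {j : Fin n} (hb : b j = 0) :
    ⁅mono F p b • partialDeriv F p j, mono F p (Finsupp.single j 2) • partialDeriv F p j⁆ =
      (2 : F) • (mono F p (b + Finsupp.single j 1) • partialDeriv F p j : WittJacobson F p n) := by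
  have hb' : partialDeriv F p j (mono F p b) = 0 := by
    rw [partialDeriv_mono, hb, Nat.cast_zero, zero_smul]
  refine ext_x fun l => ?_
  rw [Derivation.commutator_apply, Derivation.smul_apply _ (2 : F), smul_partialDeriv_x,
    smul_partialDeriv_x, smul_partialDeriv_x]
  by_cases hl : l = j
  · rw [if_pos hl, if_pos hl, if_pos hl, Derivation.smul_apply, Derivation.smul_apply, hb',
      smul_zero, sub_zero, partialDeriv_mono, mono_add_single, Finsupp.single_eq_same,
      ← Finsupp.single_tsub, mono_single, smul_eq_mul, mul_smul_comm]
    rfl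
  · rw [if_neg hl, if_neg hl, if_neg hl, map_zero, map_zero, sub_zero, smul_zero]

theorem span_mono_smul_partialDeriv :
    Submodule.span F (Set.range fun q : (Fin n →₀ ℕ) × Fin n =>
      (mono F p q.1 • partialDeriv F p q.2 : WittJacobson F p n)) = ⊤ := by
  refine eq_top_iff.2 fun Y _ => ?_
  have hY : Y = ofCoords fun l => Y (x F p n l) :=
    ext_x fun l => (ofCoords_x (fun l => Y (x F p n l)) l).symm
  rw [hY, ofCoords]
  refine Submodule.sum_mem _ fun l _ => ?_
  have hf : Y (x F p n l) ∈ Submodule.span F (Set.range (mono F p (n := n))) := by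
    rw [span_mono]
    trivial
  generalize Y (x F p n l) = f at hf ⊢
  induction hf using Submodule.span_induction with
  | mem f hf =>
    obtain ⟨a, rfl⟩ := hf
    exact Submodule.subset_span ⟨(a, l), rfl⟩
  | zero => rw [zero_smul_partialDeriv]; exact Submodule.zero_mem _
  | add f g _ _ hf hg => rw [add_smul]; exact Submodule.add_mem _ hf hg
  | smul c f _ hf => rw [smul_assoc]; exact Submodule.smul_mem _ _ hf

/-! ### Derivations of W(n) are inner. -/

section LieDerivation

variable (D : LieDerivation F (WittJacobson F p n) (WittJacobson F p n))

/-- The coefficients of `D ∂ᵢ` are `∂ᵢ`-derivatives. -/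
theorem exists_partialDeriv_eq_apply (i l : Fin n) :
    ∃ u, partialDeriv F p i u = D (partialDeriv F p i) (x F p n l) := by
  -- The xᵢ-coefficient of D[∂ᵢ, Y] contains D(∂ᵢ)(xₗ); the other terms combine into a
  -- ∂ᵢ-derivative.
  set Y : WittJacobson F p n := x F p n l • partialDeriv F p i
  have hY : ⁅partialDeriv F p i, Y⁆ = if l = i then partialDeriv F p i else 0 := by
    refine ext_x fun k => ?_
    rw [partialDeriv_lie_x, smul_partialDeriv_x]
    split_ifs with h1 h2 h2
    · rw [h1, h2]
    · rw [partialDeriv_x, if_neg h2, Derivation.zero_apply]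
    · rw [map_zero, partialDeriv_x, if_neg h1]
    · rw [map_zero, Derivation.zero_apply]
  have hD := congrArg (fun Z : WittJacobson F p n => Z (x F p n i))
    (D.apply_lie_eq_add (partialDeriv F p i) Y)
  simp only [Derivation.add_apply, partialDeriv_lie_x] at hD
  rw [Derivation.commutator_apply, smul_partialDeriv_x, if_pos rfl, Derivation.smul_apply,
    hY] at hD
  refine ⟨x F p n l * D (partialDeriv F p i) (x F p n i) - D Y (x F p n i), ?_⟩
  rw [map_sub, Derivation.leibniz, partialDeriv_x]
  split_ifs at hD ⊢ with h
  · subst h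
    simp only [smul_eq_mul] at hD ⊢
    linear_combination hD
  · rw [map_zero, Derivation.zero_apply] at hD
    simp only [smul_eq_mul] at hD ⊢
    linear_combination hD

/-- Every derivation of `W(n)` agrees with an inner one on the partial derivatives. -/
theorem exists_inner_eq_on_partialDeriv :
    ∃ X : WittJacobson F p n, ∀ i, D (partialDeriv F p i) = ⁅X, partialDeriv F p i⁆ := by
  have (l : Fin n) : ∃ g, ∀ i, partialDeriv F p i g =
      D (partialDeriv F p i) (x F p n l) := by
    refine exists_partialDeriv_eq (fun i k => ?_) fun i => exists_partialDeriv_eq_apply D i l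
    have hD := congrArg (fun Z : WittJacobson F p n => Z (x F p n l))
      (D.apply_lie_eq_add (partialDeriv F p i) (partialDeriv F p k))
    simp only [Derivation.add_apply, partialDeriv_lie_x, lie_partialDeriv_x] at hD
    rw [lie_partialDeriv_partialDeriv, map_zero, Derivation.zero_apply] at hD
    linear_combination hD
  choose g hg using this
  refine ⟨-ofCoords g, fun i => ext_x fun l => ?_⟩
  rw [lie_partialDeriv_x, Derivation.neg_apply, ofCoords_x, map_neg, neg_neg, hg]

variable {D}

/-- A derivation of `W(n)` killing the partial derivatives agrees on the toral elements with an
inner one that also kills the partial derivatives. -/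
theorem exists_inner_eq_on_toral (h0 : ∀ i, D (partialDeriv F p i) = 0) :
    ∃ X : WittJacobson F p n, (∀ i : Fin n, ⁅X, partialDeriv F p i⁆ = 0) ∧
      ∀ i, D (toral F p i) = ⁅X, toral F p i⁆ := by
  have (i : Fin n) : ∃ c : Fin n → F, ∀ l,
      D (toral F p i) (x F p n l) = algebraMap F _ (c l) := by
    refine exists_coords_of_lie_eq_zero fun k => ?_
    rw [← D.apply_lie_of_left (h0 k), partialDeriv_lie_toral]
    split_ifs
    · exact h0 i
    · exact map_zero D
  choose c hc using this
  -- In the xₖ-coefficient of D[xᵢ∂ᵢ, xₖ∂ₖ] = 0, every other term differentiates a constant or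
  -- applies a field to zero.
  have hoff (i k : Fin n) (hik : k ≠ i) : D (toral F p i) (x F p n k) = 0 := by
    have hD := congrArg (fun Z : WittJacobson F p n => Z (x F p n k))
      (D.apply_lie_eq_add (toral F p i) (toral F p k))
    simp only [Derivation.add_apply, Derivation.commutator_apply, toral_lie_toral] at hD
    rw [map_zero, Derivation.zero_apply, toral_x, toral_x, if_pos rfl, if_neg hik, hc k, hc i,
      Derivation.map_algebraMap, Derivation.map_algebraMap, map_zero, ← hc i] at hD
    linear_combination -hD
  refine ⟨ofCoords fun l => D (toral F p l) (x F p n l), fun i => ext_x fun l => ?_,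
    fun i => ext_x fun l => ?_⟩
  · rw [lie_partialDeriv_x, ofCoords_x, hc, Derivation.map_algebraMap, neg_zero,
      Derivation.zero_apply]
  · rw [Derivation.commutator_apply, ofCoords_x, toral_x, hc l l, Derivation.map_algebraMap,
      sub_zero]
    split_ifs with h
    · rw [h, ofCoords_x]
    · rw [map_zero, hoff i l h]

/-- A nonzero value of a derivation killing the partial derivatives and the toral elements on a
basis vector field, when it has constant coefficients, forces the weight of that vector field. -/
theorem exists_weight_eq (h1 : ∀ i, D (toral F p i) = 0) {a : Fin n →₀ ℕ} {j : Fin n}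
    (hcomm : ∀ k : Fin n, ⁅partialDeriv F p k, D (mono F p a • partialDeriv F p j)⁆ = 0)
    (hne : D (mono F p a • partialDeriv F p j) ≠ 0) :
    ∃ k, ∀ i, (a i : F) - (if i = j then 1 else 0) = -if k = i then 1 else 0 := by
  obtain ⟨d, hd⟩ := exists_coords_of_lie_eq_zero hcomm
  obtain ⟨k, hk⟩ : ∃ k, D (mono F p a • partialDeriv F p j) (x F p n k) ≠ 0 := by
    by_contra! hc
    exact hne (ext_x fun k => by rw [hc, Derivation.zero_apply])
  refine ⟨k, fun i => ?_⟩
  have hD := congrArg (fun Z : WittJacobson F p n => Z (x F p n k))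
    (D.apply_lie_of_left (h1 i) (mono F p a • partialDeriv F p j))
  simp only [toral_lie_mono, map_smul, Derivation.smul_apply, Derivation.commutator_apply] at hD
  rw [hd k, Derivation.map_algebraMap, toral_x, ← hd k] at hD
  -- D commutes with ad(xᵢ∂ᵢ), so xᵃ∂ⱼ and the ∂ₖ-component of its constant image have equal
  -- weights.
  have hsmul : ((a i : F) - (if i = j then 1 else 0) + if k = i then 1 else 0) •
      D (mono F p a • partialDeriv F p j) (x F p n k) = 0 := by
    rw [add_smul, hD]
    split_ifs
    · rw [one_smul, zero_sub, neg_add_cancel]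
    · rw [map_zero, sub_zero, zero_smul, add_zero]
  exact eq_neg_of_add_eq_zero_left ((smul_eq_zero.1 hsmul).resolve_right hk)

/-- A derivation of `W(n)` killing the partial derivatives and the toral elements is zero. -/
theorem eq_zero_of_apply_toral (hp : 3 ≤ p) (h0 : ∀ i, D (partialDeriv F p i) = 0)
    (h1 : ∀ i, D (toral F p i) = 0) (Y : WittJacobson F p n) : D Y = 0 := by
  have key (d : ℕ) : ∀ a : Fin n →₀ ℕ, a.degree = d → ∀ j,
      D (mono F p a • partialDeriv F p j) = 0 := by
    induction d using Nat.strong_induction_on with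
    | _ d ih =>
    rintro a rfl j
    by_cases ha : ∀ i, a i < p
    swap
    · rw [mono_eq_zero ha, zero_smul_partialDeriv, map_zero]
    -- Weights are known only modulo p; the bound aᵢ < p recovers the exponents.
    have cast_eq {i : Fin n} {m : ℕ} (hm : m < p) (h : (a i : F) = m) : a i = m := by
      have := (CharP.natCast_eq_natCast F p).1 h
      rwa [Nat.ModEq, Nat.mod_eq_of_lt (ha i), Nat.mod_eq_of_lt hm] at this
    have hcomm (k : Fin n) : ⁅partialDeriv F p k, D (mono F p a • partialDeriv F p j)⁆ = 0 := by
      rw [← D.apply_lie_of_left (h0 k), partialDeriv_lie_mono, map_smul]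
      by_cases hk : a k = 0
      · rw [hk, Nat.cast_zero, zero_smul]
      · have hle : Finsupp.single k 1 ≤ a := by
          rw [Finsupp.single_le_iff]
          omega
        have hdeg := congrArg Finsupp.degree (tsub_add_cancel_of_le hle)
        rw [map_add, Finsupp.degree_single] at hdeg
        rw [ih _ (by omega) _ rfl, smul_zero]
    by_contra hne
    obtain ⟨k, hk⟩ := exists_weight_eq h1 hcomm hne
    by_cases hkj : k = j
    · refine hne ?_
      have : a = 0 := by
        refine Finsupp.ext fun i => cast_eq (m := 0) (by omega) ?_
        have := hk i
        rw [hkj] at this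
        simp only [eq_comm (a := j)] at this
        rw [Nat.cast_zero]
        linear_combination this
      rw [this, mono_zero, one_smul, h0]
    · have haj : a j = 1 := by
        refine cast_eq (by omega) ?_
        have := hk j
        rw [if_pos rfl, if_neg hkj] at this
        rw [Nat.cast_one]
        linear_combination this
      have hak : a k = p - 1 := by
        refine cast_eq (by omega) ?_
        have := hk k
        rw [if_neg hkj, if_pos rfl] at this
        rw [Nat.cast_sub (by omega), CharP.cast_eq_zero F p, Nat.cast_one]
        linear_combination this
      have hle : Finsupp.single j 1 ≤ a := by
        rw [Finsupp.single_le_iff]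
        omega
      obtain ⟨b, rfl⟩ := exists_add_of_le hle
      rw [add_comm] at *
      have hbj : b j = 0 := by simpa using haj
      have hbk : b k = p - 1 := by simpa [Finsupp.single_apply, Ne.symm hkj] using hak
      have hbdeg : p - 1 ≤ b.degree := hbk ▸ Finsupp.le_degree k b
      have hdeg : (b + Finsupp.single j 1).degree = b.degree + 1 := by
        rw [map_add, Finsupp.degree_single]
      -- Since deg b ≥ p - 1 ≥ 2, both xᵇ∂ⱼ and xⱼ²∂ⱼ have degree below deg b + 1, so the induction
      -- hypothesis applies to each.
      have hD := D.apply_lie_eq_zero (ih _ (by omega) b rfl j)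
        (ih _ (by rw [Finsupp.degree_single]; omega) (Finsupp.single j 2) rfl j)
      rw [mono_lie_sq hbj, map_smul] at hD
      have h2 : (2 : F) ≠ 0 := by
        have := (CharP.cast_eq_zero_iff F p 2).not.2 (Nat.not_dvd_of_pos_of_lt two_pos hp)
        exact_mod_cast this
      exact hne ((smul_eq_zero.1 hD).resolve_left h2)
  have hY : Y ∈ Submodule.span F (Set.range fun q : (Fin n →₀ ℕ) × Fin n =>
      (mono F p q.1 • partialDeriv F p q.2 : WittJacobson F p n)) := by
    rw [span_mono_smul_partialDeriv]
    trivial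
  induction hY using Submodule.span_induction with
  | mem Y hY =>
    obtain ⟨q, rfl⟩ := hY
    exact key _ q.1 rfl q.2
  | zero => exact map_zero D
  | add Y Z _ _ hY hZ => rw [map_add, hY, hZ, add_zero]
  | smul c Y _ hY => rw [map_smul, hY, smul_zero]

/-- Every derivation of the Witt–Jacobson algebra in characteristic at least `3` is inner. -/
theorem exists_eq_lie (hp : 3 ≤ p)
    (D : LieDerivation F (WittJacobson F p n) (WittJacobson F p n)) :
    ∃ X : WittJacobson F p n, ∀ Y : WittJacobson F p n, D Y = ⁅X, Y⁆ := by
  obtain ⟨X₁, hX₁⟩ := exists_inner_eq_on_partialDeriv D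
  refine D.exists_eq_lie_of_sub X₁ fun D₁ hD₁ => ?_
  have h₁ (i : Fin n) : D₁ (partialDeriv F p i) = 0 := by rw [hD₁, hX₁, sub_self]
  obtain ⟨X₂, hX₂, hX₂'⟩ := exists_inner_eq_on_toral h₁
  obtain ⟨D₂, hD₂⟩ := D₁.exists_apply_eq_sub_lie X₂
  refine ⟨X₂, fun Y => sub_eq_zero.1 ((hD₂ Y).symm.trans ?_)⟩
  exact eq_zero_of_apply_toral hp (fun i => by rw [hD₂, h₁, hX₂, sub_self])
    (fun i => by rw [hD₂, hX₂', sub_self]) Y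

end LieDerivation

end WittJacobson

/-! ### From inner derivations to vanishing cohomology. -/

namespace LieModule.Cohomology

/-- If all derivations of a Lie algebra are inner, its first adjoint cohomology vanishes. -/
theorem subsingleton_H1_of_forall_inner {R L : Type*} [CommRing R] [LieRing L] [LieAlgebra R L]
    (h : ∀ D : LieDerivation R L L, ∃ x : L, ∀ y : L, D y = ⁅x, y⁆) :
    Subsingleton (H1 R L L) := by
  rw [Submodule.Quotient.subsingleton_iff, Submodule.submoduleOf_eq_top]
  intro f hf
  have hf' (x y : L) : f ⁅x, y⁆ = ⁅x, f y⁆ - ⁅y, f x⁆ := by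
    have h0 : d₁₂ R L L f x y = 0 := by
      rw [LinearMap.mem_ker.1 hf]
      rfl
    rw [d₁₂_apply_apply] at h0
    exact (sub_eq_zero.1 h0).symm
  obtain ⟨x, hx⟩ := h ⟨f, hf'⟩
  -- The coboundary of m is y ↦ ⁅y, m⁆, whereas ad x is y ↦ ⁅x, y⁆; hence the sign.
  refine ⟨-x, LinearMap.ext fun y => ?_⟩
  change ⁅y, -x⁆ = f y
  rw [lie_neg, lie_skew]
  exact (hx y).symm

end LieModule.Cohomology

theorem theorem3p1 (F : Type*) [Field F] (p : ℕ) [CharP F p] (hp : 3 ≤ p) (n : ℕ) :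
    Subsingleton (LieModule.Cohomology.H1 F (WittJacobson F p n) (WittJacobson F p n)) ∧
      ∀ D : LieDerivation F (WittJacobson F p n) (WittJacobson F p n),
        ∃ X : WittJacobson F p n, ∀ Y : WittJacobson F p n, D Y = ⁅X, Y⁆ := by
  exact ⟨LieModule.Cohomology.subsingleton_H1_of_forall_inner (WittJacobson.exists_eq_lie hp),
      WittJacobson.exists_eq_lie hp⟩
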